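/- Let $G$ be a simply connected real Lie group with Lie algebra $\mathfrak g$, and let $H\subset G$ be a closed connected subgroup with Lie algebra $\mathfrak h$. Let $\mathfrak m\subset\mathfrak g$ be a subspace with $\mathfrak g=\mathfrak h\oplus\mathfrak m$, $[\mathfrak h,\mathfrak m]\subset\mathfrak m$, $[\mathfrak m,\mathfrak m]\subset\mathfrak h$. Let $\omega_0$ be an $\mathrm{ad}(\mathfrak h)$-invariant non-degenerate skew-symmetric bilinear form on $\mathfrak m$ and let $J_0$ be an $\mathrm{ad}(\mathfrak h)$-invariant complex structure on $\mathfrak m$ such that $\mathbf g_0(X,Y)=\omega_0(X,J_0Y)$ is an inner product, so that $M=G/H$, with the induced structures, is a Hermitian symmetric space. Let $(X_1,\dots,X_{2n})$ be a basis of $\mathfrak m$ that is symplectic, i.e. $\omega_0(X_j,X_k)=\omega_0(X_{n+j},X_{n+k})=0$ and $\omega_0(X_j,X_{n+k})=\delta_{jk}$ for $1\le j,k\le n$. Let $\rho:\mathrm{Mp}(\mathfrak m)\to\mathrm{Sp}(\mathfrak m)$ be the metaplectic group (the connected double cover) and $\boldsymbol m:\mathrm{Mp}(\mathfrak m)\to\mathrm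 U(L^2(\mathbb R^n))$ the metaplectic representation, both formed with respect to this basis. Let $\tilde\kappa:H\to\mathrm{Mp}(\mathfrak m)$ be a continuous homomorphism with $\rho\circ\tilde\kappa=\mathrm{Ad}|_H$ on $\mathfrak m$, and put $\lambda=\boldsymbol m\circ\tilde\kappa$. A symplectic spinor field, i.e. a smooth section $\varphi\in\Gamma(Q)$ of $Q=G\times_\lambda L^2(\mathbb R^n)$, is a smooth map $\varphi:G\to L^2(\mathbb R^n)$ with $\varphi(gh)=\lambda(h^{-1})\varphi(g)$ for $g\in G$, $h\in H$. For $X\in\mathfrak g$ put $X(\varphi)(g)=\mathrm d\varphi(\mathrm dL_gX)$. Identifying $T_{gH}M$ with $\mathfrak m$ by $X\mapsto[g,X]=\mathrm d\pi(\mathrm dL_gX)$, where $\pi:G\to M$ is the projection, the spinor derivative is $\nabla_{[g,X]}\varphi=[g,\mathrm d\varphi(\mathrm dL_gX)]$. Symplectic Clifford multiplication $X\cdot f$ ($X\in\mathfrak m$, $f\in L^2(\mathbb R^n)$) is linear in $X$ and given by $X_j\cdot f=\mathrm i x_jf$, $X_{n+j}\cdot f=\partial f/\partial x^j$ for $1\le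 j\le n$. It is evaluated in the space $\mathcal S'(\mathbb R^n)$ of tempered distributions; as an unbounded operator on $L^2(\mathbb R^n)$, $X\cdot$ has the domain $\{f\in L^2(\mathbb R^n): X\cdot f\in L^2(\mathbb R^n)\}$. Put $\mu(X\otimes f)=X\cdot f$. The second symplectic Dirac operator is $\tilde{\mathcal D}=\mu\circ(\bar{\mathbf g}\otimes\mathrm{id}_Q)\circ\nabla$, where $\bar{\mathbf g}:T^*M\to TM$ is the identification by means of the Riemannian metric induced by $\mathbf g_0$. Suppose that the basis is unitary, i.e. that in addition $J_0X_j=X_{n+j}$ for $j=1,\dots,n$. Then $$\tilde{\mathcal D}(\varphi)=\sum_{j=1}^{2n}X_j\cdot X_j(\varphi)\qquad\text{for every }\varphi\in\Gamma(Q),$$ as an equality of maps $G\to\mathcal S'(\mathbb R^n)$. In particular, at each $g\in G$ such that $X_j(\varphi)(g)$ lies in the domain of the unbounded operator $X_j\cdot$ for every $j=1,\dots,2n$, $\tilde{\mathcal D}(\varphi)(g)$ belongs to $L^2(\mathbb R^n)$ and the equality holds in $L^2(\mathbb R^n)$. -/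

import Mathlib

open MeasureTheory Module
open scoped Manifold ContDiff SchwartzMap LineDeriv TensorProduct

noncomputable section

namespace SymplecticSpin

/-! ### The Hilbert space `L²(ℝⁿ)` and symplectic Clifford multiplication -/

/-- The complex Hilbert space `L²(ℝⁿ)`. -/
abbrev L2 (n : ℕ) : Type := Lp ℂ 2 (volume : Measure (EuclideanSpace ℝ (Fin n)))

/-- The tempered distributions on `ℝⁿ`. -/
abbrev Temp (n : ℕ) : Type := 𝓢'(EuclideanSpace ℝ (Fin n), ℂ)

/-- The embedding `L²(ℝⁿ) ⊂ 𝓢'(ℝⁿ)`. -/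
def embed (n : ℕ) : L2 n →ₗ[ℂ] Temp n :=
  (Lp.toTemperedDistributionCLM ℂ (volume : Measure (EuclideanSpace ℝ (Fin n))) 2).toLinearMap

theorem embed_injective (n : ℕ) : Function.Injective (embed n) :=
  LinearMap.ker_eq_bot.mp
    (Lp.ker_toTemperedDistributionCLM_eq_bot
      (μ := (volume : Measure (EuclideanSpace ℝ (Fin n)))) (F := ℂ) (p := 2))

/-- `f ↦ i x_j f`, as a map from `L²(ℝⁿ)` to tempered distributions. -/
def mulCoord {n : ℕ} (j : Fin n) : L2 n →ₗ[ℂ] Temp n :=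
  (TemperedDistribution.smulLeftCLM ℂ
    (fun x : EuclideanSpace ℝ (Fin n) => Complex.I * (x j : ℂ))).toLinearMap ∘ₗ embed n

/-- `f ↦ ∂f/∂x^j`, as a map from `L²(ℝⁿ)` to tempered distributions. -/
def derivCoord {n : ℕ} (j : Fin n) : L2 n →ₗ[ℂ] Temp n :=
  (LineDeriv.lineDerivOpCLM ℂ (Temp n) (EuclideanSpace.single j (1 : ℝ))).toLinearMap ∘ₗ embed n

section Vector

variable {n : ℕ} {V : Type*} [AddCommGroup V] [Module ℝ V]

/-- `b = (X_1, …, X_{2n})`, with `X_j = b (inl j)` and `X_{n+j} = b (inr j)`, is a symplectic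
basis of `(V, Ω)`. -/
structure IsSymplecticBasis (Ω : LinearMap.BilinForm ℝ V) (b : Basis (Fin n ⊕ Fin n) ℝ V) :
    Prop where
  inl_inl : ∀ j k, Ω (b (.inl j)) (b (.inl k)) = 0
  inr_inr : ∀ j k, Ω (b (.inr j)) (b (.inr k)) = 0
  inl_inr : ∀ j k, Ω (b (.inl j)) (b (.inr k)) = if j = k then 1 else 0

/-- Symplectic Clifford multiplication `X · f`, linear in `X` and `f`, with
`X_j · f = i x_j f` and `X_{n+j} · f = ∂f/∂x^j`. It is evaluated in the sense of tempered
distributions, so that `X · f` makes sense for every `f ∈ L²(ℝⁿ)`; see `cliffordOp` for the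
corresponding unbounded operator on `L²(ℝⁿ)`. -/
def clifford (b : Basis (Fin n ⊕ Fin n) ℝ V) : V →ₗ[ℝ] L2 n →ₗ[ℝ] Temp n :=
  b.constr ℝ (Sum.elim (fun j => (mulCoord j).restrictScalars ℝ)
    (fun j => (derivCoord j).restrictScalars ℝ))

/-- The map `μ₀ : V ⊗ L²(ℝⁿ) → 𝓢'(ℝⁿ)`, `μ₀ (X ⊗ f) = X · f`. -/
def mu (b : Basis (Fin n ⊕ Fin n) ℝ V) : V ⊗[ℝ] L2 n →ₗ[ℝ] Temp n :=
  TensorProduct.lift (clifford b)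

/-- The domain of `X ·` as an unbounded operator: those `f ∈ L²(ℝⁿ)` with `X · f ∈ L²(ℝⁿ)`. -/
def cliffordDomain (b : Basis (Fin n ⊕ Fin n) ℝ V) (X : V) : Submodule ℝ (L2 n) :=
  (LinearMap.range ((embed n).restrictScalars ℝ)).comap (clifford b X)

/-- `X ·` as an unbounded operator on `L²(ℝⁿ)`, on its maximal domain. -/
def cliffordOp (b : Basis (Fin n ⊕ Fin n) ℝ V) (X : V) : L2 n →ₗ.[ℝ] L2 n where
  domain := cliffordDomain b X
  toFun :=
    (LinearEquiv.ofInjective ((embed n).restrictScalars ℝ)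
      (embed_injective n)).symm.toLinearMap ∘ₗ
      ((clifford b X) ∘ₗ (cliffordDomain b X).subtype).codRestrict
        (LinearMap.range ((embed n).restrictScalars ℝ)) (fun f => f.2)

/-! ### The metaplectic group and the metaplectic representation -/

/-- The function `exp (X ·) f`, explicitly
`x ↦ exp (i (⟨p, x⟩ + ⟨p, q⟩ / 2)) f (x + q)` for `X = ∑ p_j X_j + ∑ q_j X_{n+j}`. -/
def weylFun (b : Basis (Fin n ⊕ Fin n) ℝ V) (X : V) (f : EuclideanSpace ℝ (Fin n) → ℂ) :
    EuclideanSpace ℝ (Fin n) → ℂ := fun x =>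
  Complex.exp (((∑ j, b.repr X (.inl j) * x j
      + (∑ j, b.repr X (.inl j) * b.repr X (.inr j)) / 2 : ℝ) : ℂ) * Complex.I) *
    f (x + WithLp.toLp 2 (fun j => b.repr X (.inr j)))

theorem memLp_weylFun (b : Basis (Fin n ⊕ Fin n) ℝ V) (X : V) (f : L2 n) :
    MemLp (weylFun b X f) 2 (volume : Measure (EuclideanSpace ℝ (Fin n))) := by
  have h1 : MemLp (fun x => f (x + WithLp.toLp 2 (fun j => b.repr X (.inr j)))) 2
      (volume : Measure (EuclideanSpace ℝ (Fin n))) :=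
    (Lp.memLp f).comp_measurePreserving (measurePreserving_add_right _ _)
  refine MemLp.of_le h1 (AEStronglyMeasurable.mul ?_ h1.aestronglyMeasurable) ?_
  · apply Continuous.aestronglyMeasurable
    fun_prop
  · refine Filter.Eventually.of_forall fun x => le_of_eq ?_
    rw [weylFun, norm_mul, Complex.norm_exp_ofReal_mul_I, one_mul]

/-- The Weyl operator `W(X) = exp (X ·)` on `L²(ℝⁿ)`: the Schrödinger representation. -/
def weyl (b : Basis (Fin n ⊕ Fin n) ℝ V) (X : V) (f : L2 n) : L2 n :=
  (memLp_weylFun b X f).toLp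

/-- The group of all pairs `(A, U)` of a symplectic map `A` of `(V, Ω)` and a unitary operator
`U` on `L²(ℝⁿ)` with `U W(X) U⁻¹ = W(A X)` for all `X ∈ V`. By the Stone-von Neumann theorem it is
an extension of `Sp(V)` by the circle group. -/
def MpC (Ω : LinearMap.BilinForm ℝ V) (b : Basis (Fin n ⊕ Fin n) ℝ V) :
    Subgroup ((V ≃ₗ[ℝ] V) × (L2 n ≃ₗᵢ[ℂ] L2 n)) where
  carrier := {p | (∀ X Y, Ω (p.1 X) (p.1 Y) = Ω X Y) ∧
    ∀ X f, p.2 (weyl b X f) = weyl b (p.1 X) (p.2 f)}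
  one_mem' := ⟨fun _ _ => rfl, fun _ _ => rfl⟩
  mul_mem' := by
    rintro p q ⟨hp, hp'⟩ ⟨hq, hq'⟩
    refine ⟨fun X Y => ?_, fun X f => ?_⟩
    · change Ω (p.1 (q.1 X)) (p.1 (q.1 Y)) = _
      rw [hp, hq]
    · change p.2 (q.2 _) = weyl b (p.1 (q.1 X)) (p.2 (q.2 f))
      rw [hq', hp']
  inv_mem' := by
    rintro p ⟨hp, hp'⟩
    refine ⟨fun X Y => ?_, fun X f => ?_⟩
    · change Ω (p.1.symm X) (p.1.symm Y) = _
      rw [← hp]; simp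
    · change p.2.symm _ = weyl b (p.1.symm X) (p.2.symm f)
      apply p.2.injective
      rw [hp']; simp

/-- The metaplectic group `Mp(V)`, the connected double covering group of `Sp(V)`, realized
through its (faithful) metaplectic representation: it is the commutator subgroup of `MpC`.
(For `n ≥ 1`, `MpC` is the quotient of `U(1) × Mp(V)` by the diagonal `{±1}`, and `Mp(V)` is perfect, being a
connected semisimple Lie group.) It carries the topology of `Sp(V)` and the strong operator
topology. -/
def Mp (Ω : LinearMap.BilinForm ℝ V) (b : Basis (Fin n ⊕ Fin n) ℝ V) :
    Subgroup ((V ≃ₗ[ℝ] V) × (L2 n ≃ₗᵢ[ℂ] L2 n)) :=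
  ⁅MpC Ω b, MpC Ω b⁆

/-- The covering homomorphism `ρ : Mp(V) → Sp(V) ⊂ GL(V)`. -/
def Mp.rho (Ω : LinearMap.BilinForm ℝ V) (b : Basis (Fin n ⊕ Fin n) ℝ V) :
    Mp Ω b →* (V ≃ₗ[ℝ] V) :=
  (MonoidHom.fst _ _).comp (Mp Ω b).subtype

/-- The metaplectic representation `m : Mp(V) → U(L²(ℝⁿ))`. -/
def Mp.rep (Ω : LinearMap.BilinForm ℝ V) (b : Basis (Fin n ⊕ Fin n) ℝ V) :
    Mp Ω b →* (L2 n ≃ₗᵢ[ℂ] L2 n) :=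
  (MonoidHom.snd _ _).comp (Mp Ω b).subtype

end Vector

/-! ### Lie groups and Hermitian symmetric spaces -/

section Geometry

variable {E : Type*} [NormedAddCommGroup E] [NormedSpace ℝ E]

section Basic

variable {G : Type*} [Group G] [TopologicalSpace G] [ChartedSpace E G]

/-- The Lie algebra of a closed subgroup `H` of a Lie group: the velocities `γ'(0)` of the smooth
one-parameter subgroups `γ` with image in `H`. (These form a linear subspace already, by Cartan's
theorem.) -/
def lieAlgebraOf (H : Subgroup G) : Submodule ℝ (GroupLieAlgebra 𝓘(ℝ, E) G) :=
  Submodule.span ℝ {X | ∃ γ : ℝ → G, ContMDiff 𝓘(ℝ, ℝ) 𝓘(ℝ, E) ∞ γ ∧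
    (∀ s t, γ (s + t) = γ s * γ t) ∧ (∀ t, γ t ∈ H) ∧
    mfderiv 𝓘(ℝ, ℝ) 𝓘(ℝ, E) γ 0 (1 : ℝ) = X}

variable (E) in
/-- The adjoint representation of `G`: the derivative of `x ↦ g x g⁻¹` at the unit element. -/
def Ad (g : G) (X : GroupLieAlgebra 𝓘(ℝ, E) G) : GroupLieAlgebra 𝓘(ℝ, E) G :=
  mfderiv 𝓘(ℝ, E) 𝓘(ℝ, E) (fun x : G => g * x * g⁻¹) 1 X

end Basic

variable (E) (G : Type*) [Group G] [TopologicalSpace G] [ChartedSpace E G]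

/-- The data of a simply connected symplectic symmetric space `M = G/H`, for a simply connected Lie
group `G`: a closed connected subgroup `H`, with Lie algebra `𝔥`, a decomposition `𝔤 = 𝔥 ⊕ 𝔪` with
`[𝔥, 𝔪] ⊂ 𝔪` and `[𝔪, 𝔪] ⊂ 𝔥`, and an `ad(𝔥)`-invariant symplectic form `ω₀` on `𝔪`. -/
structure SymplecticSymmetricSpace where
  H : Subgroup G
  isClosed_H : IsClosed (H : Set G)
  isConnected_H : IsConnected (H : Set G)
  m : Submodule ℝ (GroupLieAlgebra 𝓘(ℝ, E) G)
  isCompl : IsCompl (lieAlgebraOf H) m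
  lie_h_m : ∀ Z ∈ lieAlgebraOf (E := E) H, ∀ X ∈ m, ⁅Z, X⁆ ∈ m
  lie_m_m : ∀ X ∈ m, ∀ Y ∈ m, ⁅X, Y⁆ ∈ lieAlgebraOf (E := E) H
  ω₀ : LinearMap.BilinForm ℝ m
  isAlt : ω₀.IsAlt
  nondegenerate : ω₀.Nondegenerate
  ω₀_invariant : ∀ (Z) (hZ : Z ∈ lieAlgebraOf (E := E) H) (X Y : m),
    ω₀ ⟨⁅Z, (X : GroupLieAlgebra 𝓘(ℝ, E) G)⁆, lie_h_m Z hZ X X.2⟩ Y +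
      ω₀ X ⟨⁅Z, (Y : GroupLieAlgebra 𝓘(ℝ, E) G)⁆, lie_h_m Z hZ Y Y.2⟩ = 0

/-- A Hermitian symmetric space: a symplectic symmetric space with an `ad(𝔥)`-invariant complex
structure `J₀` on `𝔪` such that `g₀(X, Y) = ω₀(X, J₀ Y)` is an inner product on `𝔪`. -/
structure HermitianSymmetricSpace extends SymplecticSymmetricSpace E G where
  J₀ : m →ₗ[ℝ] m
  J₀_sq : ∀ X, J₀ (J₀ X) = -X
  J₀_invariant : ∀ (Z) (hZ : Z ∈ lieAlgebraOf (E := E) H) (X : m),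
    J₀ ⟨⁅Z, (X : GroupLieAlgebra 𝓘(ℝ, E) G)⁆, lie_h_m Z hZ X X.2⟩ =
      ⟨⁅Z, (J₀ X : GroupLieAlgebra 𝓘(ℝ, E) G)⁆, lie_h_m Z hZ _ (J₀ X).2⟩
  symm : ∀ X Y, ω₀ X (J₀ Y) = ω₀ Y (J₀ X)
  pos : ∀ X, X ≠ 0 → 0 < ω₀ X (J₀ X)

variable {E G}

/-- A lift `κ̃ : H → Mp(𝔪)` of the isotropy representation `κ = Ad|_H : H → Sp(𝔪)`, that is, a
continuous homomorphism with `ρ ∘ κ̃ = κ`. (Continuity with respect to `Sp(𝔪)` is implied by the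
lifting property, so only the strong continuity is listed.) -/
structure MetaplecticLift (M : SymplecticSymmetricSpace E G) {n : ℕ}
    (b : Basis (Fin n ⊕ Fin n) ℝ M.m) where
  toHom : M.H →* Mp M.ω₀ b
  continuous : ∀ f : L2 n, Continuous fun h => Mp.rep M.ω₀ b (toHom h) f
  lifts : ∀ (h : M.H) (X : M.m), (Mp.rho M.ω₀ b (toHom h) X : GroupLieAlgebra 𝓘(ℝ, E) G) =
    Ad E (h : G) (X : GroupLieAlgebra 𝓘(ℝ, E) G)

/-- The unitary representation `λ = m ∘ κ̃` of `H` on `L²(ℝⁿ)`. -/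
def MetaplecticLift.rep {M : SymplecticSymmetricSpace E G} {n : ℕ}
    {b : Basis (Fin n ⊕ Fin n) ℝ M.m} (κ : MetaplecticLift M b) :
    M.H →* (L2 n ≃ₗᵢ[ℂ] L2 n) :=
  (Mp.rep M.ω₀ b).comp κ.toHom

/-- The space `Γ(Q)` of symplectic spinor fields, i.e. of smooth sections of the symplectic spinor
bundle `Q = G ×_λ L²(ℝⁿ)`: smooth maps `φ : G → L²(ℝⁿ)` with `φ(gh) = λ(h⁻¹) φ(g)`. -/
structure SpinorField {M : SymplecticSymmetricSpace E G} {n : ℕ}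
    {b : Basis (Fin n ⊕ Fin n) ℝ M.m} (κ : MetaplecticLift M b) where
  toFun : G → L2 n
  smooth : ContMDiff 𝓘(ℝ, E) 𝓘(ℝ, L2 n) ∞ toFun
  equivariant : ∀ (g : G) (h : M.H), toFun (g * h) = κ.rep h⁻¹ (toFun g)

/-- `X(φ)(g) = dφ(dL_g X)`: the derivative of `φ` in the direction of the left-invariant vector
field determined by `X`. -/
def leftDeriv {n : ℕ} (X : GroupLieAlgebra 𝓘(ℝ, E) G) (φ : G → L2 n) (g : G) : L2 n :=
  mfderiv 𝓘(ℝ, E) 𝓘(ℝ, L2 n) φ g (mulInvariantVectorField X g)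

/-- The spinor derivative `∇φ` at `g`, as the linear map `X ↦ ∇_{[g, X]} φ` on `𝔪`. The tangent
space of `M = G/H` at `gH` is identified with `𝔪` by `X ↦ [g, X] = dπ(dL_g X)`; the horizontal lift
of this vector at `g`, for the `G`-invariant connection of the principal bundle `G → M` given by
`𝔤 = 𝔥 ⊕ 𝔪`, is `dL_g X`, so that `∇_{[g, X]} φ = dφ(dL_g X)`. -/
def spinorDeriv (M : SymplecticSymmetricSpace E G) {n : ℕ} (φ : G → L2 n) (g : G) :
    M.m →ₗ[ℝ] L2 n where
  toFun X := leftDeriv (X : GroupLieAlgebra 𝓘(ℝ, E) G) φ g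
  map_add' X Y := by
    simp only [leftDeriv, Submodule.coe_add, mulInvariantVectorField_add, Pi.add_apply]
    exact map_add (mfderiv 𝓘(ℝ, E) 𝓘(ℝ, L2 n) φ g) _ _
  map_smul' c X := by
    simp only [leftDeriv, Submodule.coe_smul, mulInvariantVectorField_smul, Pi.smul_apply]
    exact map_smul (mfderiv 𝓘(ℝ, E) 𝓘(ℝ, L2 n) φ g) _ _

namespace HermitianSymmetricSpace

variable (M : HermitianSymmetricSpace E G)

/-- The inner product `g₀(X, Y) = ω₀(X, J₀ Y)` on `𝔪`. -/
def g₀ : LinearMap.BilinForm ℝ M.m := M.ω₀.compRight M.J₀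

theorem g₀_nondegenerate : M.g₀.Nondegenerate := by
  have key : ∀ X, M.g₀ X X = 0 → X = 0 := fun X hX => by
    by_contra h
    exact (M.pos X h).ne' hX
  exact ⟨fun X hX => key X (hX X), fun X hX => key X (hX X)⟩

variable [FiniteDimensional ℝ E]

instance : FiniteDimensional ℝ M.m :=
  haveI : FiniteDimensional ℝ (GroupLieAlgebra 𝓘(ℝ, E) G) := inferInstanceAs (FiniteDimensional ℝ E)
  inferInstance

/-- The identification `𝔪* → 𝔪` by means of `g₀`, the inverse of `X ↦ g₀(X, ·)`. -/
def gBar : Dual ℝ M.m ≃ₗ[ℝ] M.m := (M.g₀.toDual M.g₀_nondegenerate).symm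

/-- The second symplectic Dirac operator `D̃ = μ ∘ (ḡ ⊗ id) ∘ ∇`. The spinor derivative at `g` is
viewed as an element of `𝔪* ⊗ L²(ℝⁿ)`. -/
def secondDirac {n : ℕ} (b : Basis (Fin n ⊕ Fin n) ℝ M.m)
    {κ : MetaplecticLift M.toSymplecticSymmetricSpace b} (φ : SpinorField κ) (g : G) : Temp n :=
  mu b (TensorProduct.map M.gBar.toLinearMap LinearMap.id
    ((dualTensorHomEquiv ℝ M.m (L2 n)).symm
      (spinorDeriv M.toSymplecticSymmetricSpace φ.toFun g)))

end HermitianSymmetricSpace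

end Geometry

end SymplecticSpin

end

namespace SymplecticSpin

/-! The formula is pointwise linear algebra at each g ∈ G. Since ∇φ(g) is a linear map on 𝔪, it
equals ∑ ξⱼ ⊗ Xⱼ(φ)(g) in 𝔪* ⊗ L²(ℝⁿ), with ξ the basis dual to X. A unitary symplectic basis is
`g₀`-orthonormal (`g₀_unitaryBasis`), so the metric identification sends ξⱼ to Xⱼ (`gBar_coord`),
and Clifford multiplication then yields ∑ Xⱼ · Xⱼ(φ)(g) as tempered distributions. The L² statement
follows term by term, because each unbounded operator is the distributional product pulled back
along `embed`. -/

/-- The identity `T = ∑ ξⱼ ⊗ T eⱼ` in `V* ⊗ W`, where `ξ` is the basis dual to `e`. -/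
theorem dualTensorHomEquiv_symm_eq_sum {ι V W : Type*} [Fintype ι] [DecidableEq ι]
    [AddCommGroup V] [Module ℝ V] [FiniteDimensional ℝ V] [AddCommGroup W] [Module ℝ W]
    (e : Module.Basis ι ℝ V) (T : V →ₗ[ℝ] W) :
    (dualTensorHomEquiv ℝ V W).symm T = ∑ j, e.coord j ⊗ₜ[ℝ] T (e j) := by
  -- Back in Hom(V, W), the sum becomes v ↦ ∑ ξⱼ(v) T eⱼ, which is compared with T on basis vectors.
  rw [LinearEquiv.symm_apply_eq]
  refine e.ext fun k => ?_
  simp [dualTensorHomEquiv, dualTensorHom_apply, Finsupp.single_apply]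

namespace HermitianSymmetricSpace

variable {E : Type*} [NormedAddCommGroup E] [NormedSpace ℝ E]
  {G : Type*} [Group G] [TopologicalSpace G] [ChartedSpace E G]
  (M : HermitianSymmetricSpace E G) {n : ℕ} {X : Module.Basis (Fin n ⊕ Fin n) ℝ M.m}

/-- A unitary symplectic basis is orthonormal for `g₀`. -/
theorem g₀_unitaryBasis (hX : IsSymplecticBasis M.ω₀ X)
    (hJ : ∀ j : Fin n, M.J₀ (X (.inl j)) = X (.inr j)) (j k : Fin n ⊕ Fin n) :
    M.g₀ (X j) (X k) = if j = k then 1 else 0 := by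
  have hJ' (i : Fin n) : M.J₀ (X (.inr i)) = -X (.inl i) := by rw [← hJ, M.J₀_sq]
  have hg (Y Z : M.m) : M.g₀ Y Z = M.ω₀ Y (M.J₀ Z) := rfl
  rw [hg]
  rcases j with j | j <;> rcases k with k | k
  · simp [hJ, hX.inl_inr]
  · simp [hJ', hX.inl_inl]
  · simp [hJ, hX.inr_inr]
  -- The sign from J₀² = -1 is absorbed by skew-symmetry: ω₀(Xₙ₊ⱼ, -Xₖ) = ω₀(Xₖ, Xₙ₊ⱼ).
  · rw [hJ', map_neg, LinearMap.BilinForm.IsAlt.neg_eq M.isAlt, hX.inl_inr]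
    simp [eq_comm]

variable [FiniteDimensional ℝ E]

/-- By orthonormality the functional g₀(Xⱼ, ·) is the j-th coordinate, so inverting Y ↦ g₀(Y, ·)
introduces no signs or permutation of indices. -/
theorem gBar_coord (hX : IsSymplecticBasis M.ω₀ X)
    (hJ : ∀ j : Fin n, M.J₀ (X (.inl j)) = X (.inr j)) (j : Fin n ⊕ Fin n) :
    M.gBar (X.coord j) = X j := by
  rw [gBar, LinearEquiv.symm_apply_eq]
  refine X.ext fun k => ?_
  rw [LinearMap.BilinForm.toDual_def, M.g₀_unitaryBasis hX hJ]
  simp [Finsupp.single_apply, eq_comm]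

theorem secondDirac_eq_sum (hX : IsSymplecticBasis M.ω₀ X)
    (hJ : ∀ j : Fin n, M.J₀ (X (.inl j)) = X (.inr j))
    {κ : MetaplecticLift M.toSymplecticSymmetricSpace X} (φ : SpinorField κ) (g : G) :
    M.secondDirac X φ g =
      ∑ j, clifford X (X j) (leftDeriv (X j : GroupLieAlgebra 𝓘(ℝ, E) G) φ.toFun g) := by
  rw [secondDirac, dualTensorHomEquiv_symm_eq_sum X]
  simp only [map_sum, TensorProduct.map_tmul, LinearEquiv.coe_coe, LinearMap.id_apply,
    M.gBar_coord hX hJ]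
  -- On pure tensors `mu` is `clifford` and `spinorDeriv` on Xⱼ is `leftDeriv`, both by definition.
  rfl

end HermitianSymmetricSpace

/-- The operator inverts `embed` on its range, so applying `embed` again recovers the distribution.
This bridges the two readings of Clifford multiplication. -/
theorem embed_cliffordOp {n : ℕ} {V : Type*} [AddCommGroup V] [Module ℝ V]
    (b : Module.Basis (Fin n ⊕ Fin n) ℝ V) (Y : V) (f : (cliffordOp b Y).domain) :
    embed n (cliffordOp b Y f) = clifford b Y f :=
  congrArg Subtype.val ((LinearEquiv.ofInjective ((embed n).restrictScalars ℝ)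
    (embed_injective n)).apply_symm_apply ⟨clifford b Y f, f.2⟩)

end SymplecticSpin

theorem mainTheorem10 {E : Type*} [NormedAddCommGroup E] [NormedSpace ℝ E] [FiniteDimensional ℝ E]
    {G : Type*} [Group G] [TopologicalSpace G] [ChartedSpace E G] [LieGroup 𝓘(ℝ, E) ∞ G]
    [SimplyConnectedSpace G]
    (M : SymplecticSpin.HermitianSymmetricSpace E G) {n : ℕ}
    (X : Module.Basis (Fin n ⊕ Fin n) ℝ M.m)
    (hX : SymplecticSpin.IsSymplecticBasis M.ω₀ X)
    (hJ : ∀ j : Fin n, M.J₀ (X (.inl j)) = X (.inr j))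
    (κ : SymplecticSpin.MetaplecticLift M.toSymplecticSymmetricSpace X)
    (φ : SymplecticSpin.SpinorField κ) :
    (∀ g : G, M.secondDirac X φ g =
      ∑ j, SymplecticSpin.clifford X (X j)
        (SymplecticSpin.leftDeriv (X j : GroupLieAlgebra 𝓘(ℝ, E) G) φ.toFun g)) ∧
    (∀ (g : G) (hdom : ∀ j, SymplecticSpin.leftDeriv (X j : GroupLieAlgebra 𝓘(ℝ, E) G) φ.toFun g ∈
        (SymplecticSpin.cliffordOp X (X j)).domain),
      M.secondDirac X φ g = SymplecticSpin.embed n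
        (∑ j, SymplecticSpin.cliffordOp X (X j) ⟨_, hdom j⟩)) := by
  have h := M.secondDirac_eq_sum hX hJ φ
  refine ⟨h, fun g hdom => ?_⟩
  -- Linearity of `embed` reduces the L² claim to the individual summands, each in its own
  -- operator's domain.
  rw [h, map_sum]
  exact Finset.sum_congr rfl fun j _ => (SymplecticSpin.embed_cliffordOp X (X j) ⟨_, hdom j⟩).symm
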